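/- Fix an integer $k\ge 1$. A piece is a $1\times k$ rectangle, occupying a segment $[x,x+k]$ of some floor, $x\in\mathbb Z$. A tower is a finite sequence of floors such that the bottom floor consists of one or more contiguous pieces (no gaps, no overlaps), and every higher floor is a non-empty set of pairwise non-overlapping pieces, each of which touches at least one piece of the floor directly below along a segment of positive length but is not exactly aligned with (i.e. does not occupy the same segment as) any piece of the floor directly below. A pyramid is a tower whose bottom floor consists of a single piece, and a half-pyramid is a pyramid in which no piece has its left end strictly to the left of the left end of the bottom piece. Towers are counted up to horizontal translation. For each $n$ there are finitely many towers with $n$ pieces. Let $H,P,M\in\mathbb Q[[b]]$ be the generating functions, in which $b$ marks the number of pieces, of half-pyramids, pyramids and towers, respectively. Then $H(0)=0$ and $$H=b\bigl((1+H)^k-H\bigr),\qquad P=\frac{H}{1-(k-1)H},\qquad M=\frac{H}{(1-(k-1)H)(1-H)}.$$ In the case $k=2$, for every $n\ge 1$ the number of towers with $n$ pieces is $3^{n-1}$. -/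

import Mathlib

namespace AlignFreeTowers

/-- A two-dimensional configuration of pieces of one fixed size `k`: the list of its floors, from
the bottom floor upwards. A floor is recorded as the finite set of the left ends of its pieces;
the piece with left end `x` occupies the segment `[x, x + k]` of that floor. -/
abbrev Config : Type := List (Finset ℤ)

/-- For `k ≥ 1`: the segments `[x, x + k]` and `[y, y + k]` have a common part of positive
length. -/
def Overlap (k : ℕ) (x y : ℤ) : Prop := x < y + k ∧ y < x + k

/-- `G` may be built as the next floor directly on top of the floor `F`: it has at least one piece,
its pieces do not overlap each other, each of them touches some piece of `F`, and none of them is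
exactly aligned with a piece of `F`. -/
structure CanPlaceOn (k : ℕ) (F G : Finset ℤ) : Prop where
  nonempty : G.Nonempty
  disjoint : ∀ x ∈ G, ∀ y ∈ G, x ≠ y → ¬ Overlap k x y
  supported : ∀ y ∈ G, ∃ x ∈ F, Overlap k x y
  not_aligned : ∀ y ∈ G, y ∉ F

/-- The floor made of `m` contiguous pieces (no gaps, no overlaps), with leftmost left end `a`. -/
def contiguousFloor (k : ℕ) (a : ℤ) (m : ℕ) : Finset ℤ :=
  (Finset.range m).image fun i : ℕ => a + (k : ℤ) * (i : ℤ)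

/-- Towers of `k`-mers without exact alignment whose bottom floor has leftmost left end `a`:
the bottom floor consists of one or more contiguous pieces, and each further floor may be
built on the one right below it. -/
def IsTower (k : ℕ) (a : ℤ) (T : Config) : Prop :=
  (∃ m : ℕ, 1 ≤ m ∧ T.head? = some (contiguousFloor k a m)) ∧ T.IsChain (CanPlaceOn k)

/-- A pyramid is a tower whose bottom floor consists of a single piece. -/
def IsPyramid (k : ℕ) (a : ℤ) (T : Config) : Prop :=
  IsTower k a T ∧ T.head? = some {a}

/-- A half-pyramid is a pyramid in which no piece, on any floor, sticks out to the left of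
the bottom piece. -/
def IsHalfPyramid (k : ℕ) (a : ℤ) (T : Config) : Prop :=
  IsPyramid k a T ∧ ∀ F ∈ T, ∀ y ∈ F, a ≤ y

/-- The total number of pieces. -/
def numPieces (T : Config) : ℕ := (T.map Finset.card).sum

/-- The configurations with property `p` that have exactly `n` pieces. -/
def withPieces (p : Config → Prop) (n : ℕ) : Set Config := {T | p T ∧ numPieces T = n}

/-- The generating function, in the variable `b = X`, of the configurations with property `p`
by number of pieces. -/
noncomputable def genFun (p : Config → Prop) : PowerSeries ℚ :=
  PowerSeries.mk fun n => ((withPieces p n).ncard : ℚ)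

/-- Generating function of half-pyramids up to translation (normalized by `a = 0`). -/
noncomputable def H (k : ℕ) : PowerSeries ℚ := genFun (IsHalfPyramid k 0)

/-- Generating function of pyramids up to translation (normalized by `a = 0`). -/
noncomputable def P (k : ℕ) : PowerSeries ℚ := genFun (IsPyramid k 0)

/-- Generating function of towers up to translation (normalized by `a = 0`). -/
noncomputable def M (k : ℕ) : PowerSeries ℚ := genFun (IsTower k 0)

end AlignFreeTowers

namespace AlignFreeTowers

open PowerSeries

/-! Let `Z F` count the configurations with bottom floor `F` whose higher pieces lie in `U` (a
half-line for half-pyramids, all of `ℤ` otherwise), with `Z ∅ = 1`, and let `weight S` sum `Z` over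
the non-overlapping floors inside `S`. Removing the bottom floor gives `FloorRecursion`, and
everything else is algebra from it. The crux is the exchange identity `FloorRecursion.sum_union`. It
yields `FloorRecursion.peel`, which for intervals whose weight depends on a length parameter `m`
reads `(1 + X) (w (m+1) - w m) = X w (m+k)`. Its solution is determined by `w 0`, hence is
geometric. On the half-line the ratio is `1 + H`, and `m = 0` gives the equation for `H`. On the
line `w m = w 0 * (1 + H) ^ m`. A row of `m` pieces has as neighbourhood an interval of length `k -
1 + k * m`, so its generating function is `w 0 * H ^ m`. For `m = 1`, `w 0 = 1 + (k - 1) P` gives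
`P`; summing over `m ≥ 1` gives `M = P / (1 - H)`. -/

/-- No two distinct pieces of the floor overlap. -/
def Indep (k : ℕ) (F : Finset ℤ) : Prop := ∀ x ∈ F, ∀ y ∈ F, x ≠ y → ¬ Overlap k x y

open Classical in
/-- The positions in `U` of the pieces that overlap some piece of `F`. -/
noncomputable def nb (k : ℕ) (U : Set ℤ) (F : Finset ℤ) : Finset ℤ :=
  {y ∈ F.biUnion fun x => Finset.Ioo (x - k) (x + k) | y ∈ U}

open Classical in
/-- The subsets of `S` without overlapping pieces. -/
noncomputable def indepSubsets (k : ℕ) (S : Finset ℤ) : Finset (Finset ℤ) :=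
  {F ∈ S.powerset | Indep k F}

/-- The total weight of the non-overlapping floors contained in `S`. -/
noncomputable def weight (k : ℕ) (Z : Finset ℤ → PowerSeries ℚ) (S : Finset ℤ) : PowerSeries ℚ :=
  ∑ F ∈ indepSubsets k S, Z F

/-! ### Neighbourhoods, non-overlapping floors and weights -/

theorem Overlap.symm {k : ℕ} {x y : ℤ} (h : Overlap k x y) : Overlap k y x := ⟨h.2, h.1⟩

theorem Overlap.refl {k : ℕ} (hk : 1 ≤ k) (x : ℤ) : Overlap k x x := by
  constructor <;> omega

theorem mem_nb {k : ℕ} {U : Set ℤ} {F : Finset ℤ} {y : ℤ} :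
    y ∈ nb k U F ↔ (∃ x ∈ F, Overlap k x y) ∧ y ∈ U := by
  simp only [nb, Finset.mem_filter, Finset.mem_biUnion, Finset.mem_Ioo, Overlap]
  constructor
  · rintro ⟨⟨x, hx, h⟩, hU⟩
    exact ⟨⟨x, hx, by omega, by omega⟩, hU⟩
  · rintro ⟨⟨x, hx, h⟩, hU⟩
    exact ⟨⟨x, hx, by omega, by omega⟩, hU⟩

theorem mem_indepSubsets {k : ℕ} {S F : Finset ℤ} :
    F ∈ indepSubsets k S ↔ F ⊆ S ∧ Indep k F := by
  simp [indepSubsets]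

@[simp]
theorem nb_empty (k : ℕ) (U : Set ℤ) : nb k U ∅ = ∅ := by
  simp [nb]

theorem nb_union (k : ℕ) (U : Set ℤ) (F G : Finset ℤ) :
    nb k U (F ∪ G) = nb k U F ∪ nb k U G := by
  ext y
  simp only [mem_nb, Finset.mem_union]
  grind

theorem Indep.mono {k : ℕ} {F G : Finset ℤ} (hG : Indep k G) (h : F ⊆ G) : Indep k F :=
  fun x hx y hy => hG x (h hx) y (h hy)

theorem indep_empty (k : ℕ) : Indep k ∅ := by simp [Indep]

theorem indep_singleton (k : ℕ) (x : ℤ) : Indep k {x} := by simp [Indep]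

theorem indepSubsets_eq_powerset {k : ℕ} {S : Finset ℤ} (hS : Indep k S) :
    indepSubsets k S = S.powerset := by
  ext F
  simp only [mem_indepSubsets, Finset.mem_powerset]
  exact ⟨fun h => h.1, fun h => ⟨h, hS.mono h⟩⟩

@[simp]
theorem weight_empty (k : ℕ) (Z : Finset ℤ → PowerSeries ℚ) : weight k Z ∅ = Z ∅ := by
  simp [weight, indepSubsets_eq_powerset (indep_empty k)]

theorem eq_zero_of_forall_X_pow_dvd {f : PowerSeries ℚ} (h : ∀ n, (X : PowerSeries ℚ) ^ n ∣ f) :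
    f = 0 := by
  ext n
  exact X_pow_dvd_iff.1 (h (n + 1)) n (Nat.lt_succ_self n)

/-- A floor splits uniquely into its parts in `T` and in `A`; the second must avoid the neighbours
of the first. -/
theorem weight_union {k : ℕ} {U : Set ℤ} (Z : Finset ℤ → PowerSeries ℚ) {A T : Finset ℤ}
    (hA : (A : Set ℤ) ⊆ U) (hd : Disjoint A T) :
    weight k Z (A ∪ T) =
      ∑ G ∈ indepSubsets k T, ∑ G' ∈ indepSubsets k (A \ nb k U G), Z (G ∪ G') := by
  rw [Finset.sum_sigma']
  rw [weight]
  refine Finset.sum_bij' (fun F _ => ⟨F ∩ T, F ∩ A⟩) (fun p _ => p.1 ∪ p.2) ?_ ?_ ?_ ?_ ?_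
  · intro F hF
    obtain ⟨hS, hI⟩ := mem_indepSubsets.1 hF
    simp only [Finset.mem_sigma, mem_indepSubsets]
    refine ⟨⟨Finset.inter_subset_right, hI.mono Finset.inter_subset_left⟩, ?_,
      hI.mono Finset.inter_subset_left⟩
    intro y hy
    obtain ⟨hyF, hyA⟩ := Finset.mem_inter.1 hy
    refine Finset.mem_sdiff.2 ⟨hyA, fun h => ?_⟩
    obtain ⟨⟨x, hx, hxy⟩, -⟩ := mem_nb.1 h
    obtain ⟨hxF, hxT⟩ := Finset.mem_inter.1 hx
    refine hI x hxF y hyF ?_ hxy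
    rintro rfl
    exact Finset.disjoint_left.1 hd hyA hxT
  · rintro ⟨G, G'⟩ h
    simp only [Finset.mem_sigma, mem_indepSubsets] at h ⊢
    obtain ⟨⟨hGT, hG⟩, hGA, hG'⟩ := h
    have key : ∀ x ∈ G, ∀ y ∈ G', ¬ Overlap k x y := by
      intro x hx y hy ho
      have h1 := Finset.mem_sdiff.1 (hGA hy)
      exact h1.2 (mem_nb.2 ⟨⟨x, hx, ho⟩, hA h1.1⟩)
    refine ⟨?_, ?_⟩
    · refine Finset.union_subset (hGT.trans Finset.subset_union_right) ?_
      exact (hGA.trans Finset.sdiff_subset).trans Finset.subset_union_left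
    · intro x hx y hy hxy
      rcases Finset.mem_union.1 hx with hx | hx <;> rcases Finset.mem_union.1 hy with hy | hy
      · exact hG x hx y hy hxy
      · exact key x hx y hy
      · exact fun h => key y hy x hx h.symm
      · exact hG' x hx y hy hxy
  · intro F hF
    have hS := (mem_indepSubsets.1 hF).1
    rw [← Finset.inter_union_distrib_left, Finset.union_comm T A]
    exact Finset.inter_eq_left.2 hS
  · rintro ⟨G, G'⟩ h
    simp only [Finset.mem_sigma, mem_indepSubsets] at h
    obtain ⟨⟨hGT, hG⟩, hGA, hG'⟩ := h
    have hGA' : G' ⊆ A := hGA.trans Finset.sdiff_subset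
    have h1 : (G ∪ G') ∩ T = G := by
      ext x
      have := @hGT x
      have := @hGA' x
      have : x ∈ A → x ∉ T := fun h => Finset.disjoint_left.1 hd h
      simp only [Finset.mem_inter, Finset.mem_union]
      tauto
    have h2 : (G ∪ G') ∩ A = G' := by
      ext x
      have := @hGT x
      have := @hGA' x
      have : x ∈ A → x ∉ T := fun h => Finset.disjoint_left.1 hd h
      simp only [Finset.mem_inter, Finset.mem_union]
      tauto
    simp [h1, h2]
  · intro F hF
    have hS := (mem_indepSubsets.1 hF).1
    dsimp only
    rw [← Finset.inter_union_distrib_left, Finset.union_comm T A, Finset.inter_eq_left.2 hS]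

theorem nb_subset (k : ℕ) (U : Set ℤ) (F : Finset ℤ) : (nb k U F : Set ℤ) ⊆ U :=
  fun _ hy => (mem_nb.1 hy).2

/-! ### Consequences of the floor recursion -/

/-- `Z` obeys the floor-by-floor recursion of the generating functions of configurations with a
given bottom floor, all higher pieces being in positions from `U`. -/
def FloorRecursion (k : ℕ) (U : Set ℤ) (Z : Finset ℤ → PowerSeries ℚ) : Prop :=
  ∀ F, Z F = X ^ F.card * weight k Z (nb k U F \ F)

/-- Exchange argument modulo `X ^ n`. Expanding the right-hand weight over its part `G` in `T \ nb k
U F` leaves, for each `G`, the same identity with `G` as fixed floor and `nb k U F \ F` in place of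
`T`. The factor `X ^ F.card` raises the precision, so induction on `n` closes. -/
theorem FloorRecursion.dvd_sum_union_sub {k : ℕ} {U : Set ℤ} {Z : Finset ℤ → PowerSeries ℚ}
    (hk : 1 ≤ k) (hZ : FloorRecursion k U Z) (n : ℕ) :
    ∀ F T : Finset ℤ, (T : Set ℤ) ⊆ U → (X : PowerSeries ℚ) ^ n ∣
      (∑ G ∈ indepSubsets k (T \ nb k U F), Z (F ∪ G)) -
        X ^ F.card * weight k Z ((nb k U F ∪ T) \ F) := by
  induction n with
  | zero => simp
  | succ n ih =>
    intro F T hT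
    -- An empty `F` gains no factor of `X`, but then both sides are the weight of `T`.
    rcases F.eq_empty_or_nonempty with rfl | hF
    · simp [weight]
    have hA : ((nb k U F \ F : Finset ℤ) : Set ℤ) ⊆ U := fun y hy =>
      nb_subset k U F (Finset.mem_sdiff.1 hy).1
    have hd : Disjoint (nb k U F \ F) (T \ nb k U F) :=
      Finset.disjoint_left.2 fun y hy hy' =>
        (Finset.mem_sdiff.1 hy').2 (Finset.mem_sdiff.1 hy).1
    have hAT : (nb k U F ∪ T) \ F = (nb k U F \ F) ∪ (T \ nb k U F) := by
      ext y
      have : y ∈ T → y ∈ F → y ∈ nb k U F := fun h1 h2 =>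
        mem_nb.2 ⟨⟨y, h2, Overlap.refl hk y⟩, hT h1⟩
      simp only [Finset.mem_sdiff, Finset.mem_union]
      tauto
    rw [hAT, weight_union Z hA hd, Finset.mul_sum, ← Finset.sum_sub_distrib]
    refine Finset.dvd_sum fun G hG => ?_
    obtain ⟨hGT, hGI⟩ := mem_indepSubsets.1 hG
    have hFG : Disjoint F G := Finset.disjoint_left.2 fun y h1 h2 => by
      have h3 := Finset.mem_sdiff.1 (hGT h2)
      exact h3.2 (mem_nb.2 ⟨⟨y, h1, Overlap.refl hk y⟩, hT h3.1⟩)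
    have hset : nb k U (F ∪ G) \ (F ∪ G) = (nb k U G ∪ (nb k U F \ F)) \ G := by
      ext y
      have : y ∈ F → y ∉ nb k U G := fun h1 h2 => by
        obtain ⟨⟨x, hx, hxy⟩, -⟩ := mem_nb.1 h2
        have h3 := Finset.mem_sdiff.1 (hGT hx)
        exact h3.2 (mem_nb.2 ⟨⟨y, h1, hxy.symm⟩, hT h3.1⟩)
      simp only [nb_union, Finset.mem_sdiff, Finset.mem_union]
      tauto
    rw [hZ (F ∪ G), Finset.card_union_of_disjoint hFG, hset, pow_add X F.card, mul_assoc, ← mul_sub, pow_succ' X n]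
    refine mul_dvd_mul (dvd_pow_self _ hF.card_pos.ne') ?_
    -- The two sides have swapped roles, hence the change of sign below.
    have := ih G (nb k U F \ F) hA
    rwa [← dvd_neg, neg_sub] at this

theorem FloorRecursion.sum_union {k : ℕ} {U : Set ℤ} {Z : Finset ℤ → PowerSeries ℚ}
    (hk : 1 ≤ k) (hZ : FloorRecursion k U Z) (F : Finset ℤ) {T : Finset ℤ}
    (hT : (T : Set ℤ) ⊆ U) :
    ∑ G ∈ indepSubsets k (T \ nb k U F), Z (F ∪ G) =
      X ^ F.card * weight k Z ((nb k U F ∪ T) \ F) :=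
  sub_eq_zero.1 (eq_zero_of_forall_X_pow_dvd fun n => hZ.dvd_sum_union_sub hk n F T hT)

theorem FloorRecursion.weight_union {k : ℕ} {U : Set ℤ} {Z : Finset ℤ → PowerSeries ℚ}
    (hk : 1 ≤ k) (hZ : FloorRecursion k U Z) {A T : Finset ℤ}
    (hA : (A : Set ℤ) ⊆ U) (hd : Disjoint A T) :
    weight k Z (A ∪ T) =
      ∑ G ∈ indepSubsets k T, X ^ G.card * weight k Z ((nb k U G ∪ A) \ G) := by
  rw [AlignFreeTowers.weight_union Z hA hd]
  exact Finset.sum_congr rfl fun G _ => hZ.sum_union hk G hA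

theorem FloorRecursion.weight_eq_erase_add {k : ℕ} {U : Set ℤ} {Z : Finset ℤ → PowerSeries ℚ}
    (hk : 1 ≤ k) (hZ : FloorRecursion k U Z) {S : Finset ℤ} {x : ℤ}
    (hS : (S : Set ℤ) ⊆ U) (hx : x ∈ S) :
    weight k Z S = weight k Z (S.erase x) + X * weight k Z ((nb k U {x} ∪ S).erase x) := by
  have hA : ((S.erase x : Finset ℤ) : Set ℤ) ⊆ U := fun y hy => hS (Finset.mem_of_mem_erase hy)
  have h := hZ.weight_union hk (T := {x}) hA (by simp)
  have hp : ({x} : Finset ℤ).powerset = {∅, {x}} := by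
    ext F
    simp [Finset.subset_singleton_iff]
  rw [indepSubsets_eq_powerset (indep_singleton k x), hp,
    Finset.sum_pair (Finset.singleton_ne_empty x).symm] at h
  have h1 : S.erase x ∪ {x} = S := by
    rw [Finset.union_comm, ← Finset.insert_eq, Finset.insert_erase hx]
  have h2 : (nb k U {x} ∪ S.erase x) \ {x} = (nb k U {x} ∪ S).erase x := by
    ext y
    simp only [Finset.mem_sdiff, Finset.mem_union, Finset.mem_erase, Finset.mem_singleton]
    tauto
  rw [h1, h2] at h
  simpa using h

/-- Removing one piece of the bottom floor. -/
theorem FloorRecursion.peel {k : ℕ} {U : Set ℤ} {Z : Finset ℤ → PowerSeries ℚ}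
    (hk : 1 ≤ k) (hZ : FloorRecursion k U Z) {S : Finset ℤ} {x : ℤ}
    (hS : (S : Set ℤ) ⊆ U) (hx : x ∈ S) :
    (1 + X) * (weight k Z S - weight k Z (S.erase x)) = X * weight k Z (nb k U {x} ∪ S) := by
  have h1 := hZ.weight_eq_erase_add hk hS hx
  have h2 := hZ.weight_eq_erase_add hk (S := nb k U {x} ∪ S) (x := x)
    (by
      rw [Finset.coe_union]
      exact Set.union_subset (nb_subset k U {x}) hS)
    (Finset.mem_union_right _ hx)
  -- Adding the neighbours of `x` twice changes nothing, so `h1` and `h2` share the weight of `(nb k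
  -- U {x} ∪ S).erase x`, which is eliminated.
  rw [← Finset.union_assoc, Finset.union_self] at h2
  linear_combination (1 + X) * h1 - X * h2

/-- In the expansion of the weight of `nb k U F` over subsets `G` of `F`, each `G` leaves the same
set `nb k U F \ F`; the binomial theorem sums the factors `X ^ G.card`. -/
theorem FloorRecursion.one_add_X_pow_mul {k : ℕ} {U : Set ℤ} {Z : Finset ℤ → PowerSeries ℚ}
    (hk : 1 ≤ k) (hZ : FloorRecursion k U Z) {F : Finset ℤ}
    (hF : Indep k F) (hU : (F : Set ℤ) ⊆ U) :
    (1 + X) ^ F.card * Z F = X ^ F.card * weight k Z (nb k U F) := by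
  have hA : ((nb k U F \ F : Finset ℤ) : Set ℤ) ⊆ U := fun y hy =>
    nb_subset k U F (Finset.mem_sdiff.1 hy).1
  have h := hZ.weight_union hk (T := F) hA Finset.sdiff_disjoint
  have hsub : F ⊆ nb k U F := fun y hy => mem_nb.2 ⟨⟨y, hy, Overlap.refl hk y⟩, hU hy⟩
  rw [Finset.sdiff_union_of_subset hsub, indepSubsets_eq_powerset hF] at h
  have h1 : ∀ G ∈ F.powerset, X ^ G.card * weight k Z ((nb k U G ∪ (nb k U F \ F)) \ G) =
      X ^ G.card * 1 ^ (F.card - G.card) * weight k Z (nb k U F \ F) := by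
    intro G hG
    have hGF := Finset.mem_powerset.1 hG
    have : (nb k U G ∪ (nb k U F \ F)) \ G = nb k U F \ F := by
      ext y
      have h1 : y ∈ nb k U G → y ∈ F → y ∈ G := fun h1 h2 => by
        obtain ⟨⟨x, hx, hxy⟩, -⟩ := mem_nb.1 h1
        by_contra hy
        exact hF x (hGF hx) y h2 (fun e => hy (e ▸ hx)) hxy
      have h2 : y ∈ nb k U G → y ∈ nb k U F := fun h1 => by
        obtain ⟨⟨x, hx, hxy⟩, hy⟩ := mem_nb.1 h1
        exact mem_nb.2 ⟨⟨x, hGF hx, hxy⟩, hy⟩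
      have h3 := @hGF y
      simp only [Finset.mem_sdiff, Finset.mem_union]
      tauto
    rw [this, one_pow, mul_one]
  rw [Finset.sum_congr rfl h1, ← Finset.sum_mul, Finset.sum_pow_mul_eq_add_pow] at h
  rw [h, hZ F, add_comm (1 : PowerSeries ℚ) X]
  ring

/-! ### The linear recursion for interval weights -/

theorem isUnit_one_add_X : IsUnit (1 + X : PowerSeries ℚ) := by
  rw [PowerSeries.isUnit_iff_constantCoeff]
  simp

/-- Uniqueness for the linear recursion satisfied by the weights of intervals. -/
theorem eq_of_interval_recursion {k : ℕ} {v w : ℕ → PowerSeries ℚ}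
    (hv : ∀ m, (1 + X) * (v (m + 1) - v m) = X * v (m + k))
    (hw : ∀ m, (1 + X) * (w (m + 1) - w m) = X * w (m + k)) (h0 : v 0 = w 0) (m : ℕ) :
    v m = w m := by
  have key : ∀ n m, (X : PowerSeries ℚ) ^ n ∣ v m - w m := by
    intro n
    induction n with
    | zero => simp
    | succ n ih =>
      intro m
      -- The recursion looks ahead to `m + k`, but with a factor `X`: the outer induction on
      -- precision covers that term, the inner one steps from `m` to `m + 1`.
      induction m with
      | zero => simp [h0]
      | succ m ihm =>
        have h1 : (X : PowerSeries ℚ) ^ (n + 1) ∣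
            (1 + X) * ((v (m + 1) - w (m + 1)) - (v m - w m)) := by
          have : (1 + X) * ((v (m + 1) - w (m + 1)) - (v m - w m)) =
              X * (v (m + k) - w (m + k)) := by
            linear_combination hv m - hw m
          rw [this, pow_succ']
          exact mul_dvd_mul_left _ (ih _)
        rw [isUnit_one_add_X.dvd_mul_left] at h1
        simpa using dvd_add h1 ihm
  exact sub_eq_zero.1 (eq_zero_of_forall_X_pow_dvd fun n => key n m)

/-- The recursion is linear and shift-invariant, so the shift of `w` by `j` and `w j` times `w` are
solutions with the same initial value. -/
theorem eq_pow_of_interval_recursion {k : ℕ} {w : ℕ → PowerSeries ℚ}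
    (hw : ∀ m, (1 + X) * (w (m + 1) - w m) = X * w (m + k)) (h0 : w 0 = 1) (m : ℕ) :
    w m = w 1 ^ m := by
  have hadd : ∀ j m, w (m + j) = w m * w j := by
    intro j m
    refine eq_of_interval_recursion (k := k) (v := fun m => w (m + j)) (w := fun m => w m * w j)
      ?_ ?_ ?_ m
    · intro m
      have := hw (m + j)
      rwa [add_right_comm m j 1, add_right_comm m j k] at this
    · intro m
      linear_combination w j * hw m
    · simp [h0]
  induction m with
  | zero => simpa using h0
  | succ m ih => rw [hadd, ih, pow_succ]

/-! ### Interval weights on the half-line and on the line -/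

theorem FloorRecursion.half_interval {k : ℕ} {Z : Finset ℤ → PowerSeries ℚ}
    (hk : 1 ≤ k) (hZ : FloorRecursion k (Set.Ici 0) Z) (m : ℕ) :
    (1 + X) * (weight k Z (Finset.Ico 0 ((m + 1 : ℕ) : ℤ)) - weight k Z (Finset.Ico 0 (m : ℤ))) =
      X * weight k Z (Finset.Ico 0 ((m + k : ℕ) : ℤ)) := by
  have h := hZ.peel hk (S := Finset.Ico 0 ((m + 1 : ℕ) : ℤ)) (x := m)
    (fun y hy => (Finset.mem_Ico.1 hy).1) (by simp)
  have h1 : (Finset.Ico 0 ((m + 1 : ℕ) : ℤ)).erase m = Finset.Ico 0 (m : ℤ) := by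
    ext y
    simp only [Finset.mem_erase, Finset.mem_Ico]
    omega
  have h2 : nb k (Set.Ici 0) {(m : ℤ)} ∪ Finset.Ico 0 ((m + 1 : ℕ) : ℤ) =
      Finset.Ico 0 ((m + k : ℕ) : ℤ) := by
    ext y
    simp only [Finset.mem_union, mem_nb, Finset.mem_Ico, Finset.mem_singleton, exists_eq_left,
      Overlap, Set.mem_Ici]
    omega
  rwa [h1, h2] at h

/-- Without a wall, the interval must have at least `k - 1` positions to the left of the removed
one, so that its left neighbours are already inside; hence the offset `k - 1`. -/
theorem FloorRecursion.full_interval {k : ℕ} {Z : Finset ℤ → PowerSeries ℚ}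
    (hk : 1 ≤ k) (hZ : FloorRecursion k Set.univ Z) (a : ℤ) (m : ℕ) :
    (1 + X) * (weight k Z (Finset.Ico a (a + (k - 1) + (m + 1 : ℕ))) -
        weight k Z (Finset.Ico a (a + (k - 1) + (m : ℕ)))) =
      X * weight k Z (Finset.Ico a (a + (k - 1) + (m + k : ℕ))) := by
  have h := hZ.peel hk (S := Finset.Ico a (a + (k - 1) + (m + 1 : ℕ))) (x := a + (k - 1) + m)
    (Set.subset_univ _) (by simp; omega)
  have h1 : (Finset.Ico a (a + (k - 1) + (m + 1 : ℕ))).erase (a + (k - 1) + m) =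
      Finset.Ico a (a + (k - 1) + (m : ℕ)) := by
    ext y
    simp only [Finset.mem_erase, Finset.mem_Ico]
    omega
  have h2 : nb k Set.univ {a + (k - 1) + (m : ℤ)} ∪ Finset.Ico a (a + (k - 1) + (m + 1 : ℕ)) =
      Finset.Ico a (a + (k - 1) + (m + k : ℕ)) := by
    ext y
    simp only [Finset.mem_union, mem_nb, Finset.mem_Ico, Finset.mem_singleton, exists_eq_left,
      Overlap, Set.mem_univ, and_true]
    omega
  rwa [h1, h2] at h

/-- In a short interval any two pieces overlap. -/
theorem weight_short {k : ℕ} (Z : Finset ℤ → PowerSeries ℚ) {S : Finset ℤ}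
    (hS : ∀ x ∈ S, ∀ y ∈ S, Overlap k x y) :
    weight k Z S = Z ∅ + ∑ x ∈ S, Z {x} := by
  have h : indepSubsets k S = insert ∅ (S.image fun x => {x}) := by
    ext F
    simp only [mem_indepSubsets, Finset.mem_insert, Finset.mem_image]
    constructor
    · rintro ⟨hF, hI⟩
      rcases F.eq_empty_or_nonempty with h | ⟨x, hx⟩
      · exact Or.inl h
      · refine Or.inr ⟨x, hF hx, (Finset.eq_singleton_iff_unique_mem.2 ⟨hx, fun y hy => ?_⟩).symm⟩
        by_contra hne
        exact hI y hy x hx hne (hS y (hF hy) x (hF hx))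
    · rintro (rfl | ⟨x, hx, rfl⟩)
      · exact ⟨Finset.empty_subset _, indep_empty k⟩
      · exact ⟨Finset.singleton_subset_iff.2 hx, indep_singleton k x⟩
  rw [weight, h, Finset.sum_insert, Finset.sum_image]
  · intro x _ y _ hxy
    exact Finset.singleton_injective hxy
  · simp

theorem FloorRecursion.half_weight_eq_pow {k : ℕ} {Z : Finset ℤ → PowerSeries ℚ}
    (hk : 1 ≤ k) (hZ : FloorRecursion k (Set.Ici 0) Z) (h0 : Z ∅ = 1) (m : ℕ) :
    weight k Z (Finset.Ico 0 (m : ℤ)) = (1 + Z {0}) ^ m := by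
  have h1 : weight k Z (Finset.Ico 0 ((1 : ℕ) : ℤ)) = 1 + Z {0} := by
    have : Finset.Ico 0 ((1 : ℕ) : ℤ) = {0} := by
      ext y
      simp only [Finset.mem_Ico, Finset.mem_singleton]
      omega
    rw [this, weight_short Z (by simp [Overlap.refl hk]), h0]
    simp
  rw [← h1]
  exact eq_pow_of_interval_recursion (k := k) (w := fun m => weight k Z (Finset.Ico 0 (m : ℤ)))
    (hZ.half_interval hk) (by simp [h0]) m

theorem FloorRecursion.half_equation {k : ℕ} {Z : Finset ℤ → PowerSeries ℚ}
    (hk : 1 ≤ k) (hZ : FloorRecursion k (Set.Ici 0) Z) (h0 : Z ∅ = 1) :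
    Z {0} = X * ((1 + Z {0}) ^ k - Z {0}) := by
  have h := hZ.half_interval hk 0
  simp only [hZ.half_weight_eq_pow hk h0] at h
  simp only [zero_add, pow_one, pow_zero] at h
  linear_combination h

theorem FloorRecursion.full_weight_eq {k : ℕ} {Z : Finset ℤ → PowerSeries ℚ}
    (hk : 1 ≤ k) (hZ : FloorRecursion k Set.univ Z) {h : PowerSeries ℚ}
    (hh : h = X * ((1 + h) ^ k - h)) (a : ℤ) (m : ℕ) :
    weight k Z (Finset.Ico a (a + (k - 1) + m)) =
      weight k Z (Finset.Ico a (a + (k - 1))) * (1 + h) ^ m := by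
  refine eq_of_interval_recursion (k := k)
    (v := fun m : ℕ => weight k Z (Finset.Ico a (a + (k - 1) + m)))
    (w := fun m => weight k Z (Finset.Ico a (a + (k - 1))) * (1 + h) ^ m)
    (hZ.full_interval hk a) ?_ (by simp) m
  intro m
  simp only [pow_succ, pow_add]
  linear_combination weight k Z (Finset.Ico a (a + (k - 1))) * (1 + h) ^ m * hh

theorem X_dvd_of_half_equation {k : ℕ} {h : PowerSeries ℚ} (hh : h = X * ((1 + h) ^ k - h)) :
    X ∣ h := by
  rw [hh]
  exact dvd_mul_right _ _

/-! ### Contiguous bottom floors and pyramids -/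

theorem nb_contiguousFloor {k : ℕ} (hk : 1 ≤ k) (a : ℤ) {m : ℕ} (hm : 1 ≤ m) :
    nb k Set.univ (contiguousFloor k a m) =
      Finset.Ico (a - (k - 1)) (a - (k - 1) + (k - 1) + (k * m : ℕ)) := by
  ext y
  simp only [mem_nb, contiguousFloor, Finset.mem_image, Finset.mem_range, Set.mem_univ, and_true,
    Finset.mem_Ico, Overlap, exists_exists_and_eq_and]
  have hk' : (0 : ℤ) < k := by omega
  constructor
  · rintro ⟨i, hi, h1, h2⟩
    have : (k : ℤ) * (i + 1) ≤ k * m := by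
      apply mul_le_mul_of_nonneg_left _ hk'.le
      exact_mod_cast hi
    have : (0 : ℤ) ≤ k * i := by positivity
    push_cast
    constructor <;> linarith
  · rintro ⟨h1, h2⟩
    by_cases hy : y < a
    · exact ⟨0, hm, by simp; omega, by simp; omega⟩
    obtain ⟨t, rfl⟩ : ∃ t : ℕ, y = a + t := ⟨(y - a).toNat, by omega⟩
    -- The piece of index `t / k` is the one with `y` in its half-open segment.
    refine ⟨t / k, Nat.div_lt_of_lt_mul (by omega), ?_, ?_⟩
    · have : k * (t / k) ≤ t := Nat.mul_div_le t k
      have : (k : ℤ) * ((t / k : ℕ) : ℤ) ≤ t := by exact_mod_cast this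
      linarith
    · have : t < k * (t / k) + k := by
        have := Nat.div_add_mod t k
        have := Nat.mod_lt t hk
        omega
      have : (t : ℤ) < (k : ℤ) * ((t / k : ℕ) : ℤ) + k := by exact_mod_cast this
      linarith

theorem card_contiguousFloor {k : ℕ} (hk : 1 ≤ k) (a : ℤ) (m : ℕ) :
    (contiguousFloor k a m).card = m := by
  rw [contiguousFloor, Finset.card_image_of_injective, Finset.card_range]
  intro i j hij
  have hk' : k ≠ 0 := by omega
  simpa [hk'] using hij

theorem indep_contiguousFloor (k : ℕ) (a : ℤ) (m : ℕ) : Indep k (contiguousFloor k a m) := by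
  intro x hx y hy hxy
  simp only [contiguousFloor, Finset.mem_image, Finset.mem_range] at hx hy
  obtain ⟨i, -, rfl⟩ := hx
  obtain ⟨j, -, rfl⟩ := hy
  rintro ⟨h1, h2⟩
  have hk0 : (0 : ℤ) ≤ k := by positivity
  rcases lt_trichotomy i j with h | rfl | h
  · have : (k : ℤ) * (i + 1) ≤ k * j := mul_le_mul_of_nonneg_left (by exact_mod_cast h) hk0
    linarith
  · exact hxy rfl
  · have : (k : ℤ) * (j + 1) ≤ k * i := mul_le_mul_of_nonneg_left (by exact_mod_cast h) hk0
    linarith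

theorem contiguousFloor_one (k : ℕ) (a : ℤ) : contiguousFloor k a 1 = {a} := by
  simp [contiguousFloor]

theorem FloorRecursion.contiguousFloor_eq {k : ℕ} {Z : Finset ℤ → PowerSeries ℚ}
    (hk : 1 ≤ k) (hZ : FloorRecursion k Set.univ Z) {h : PowerSeries ℚ}
    (hh : h = X * ((1 + h) ^ k - h)) (a : ℤ) {m : ℕ} (hm : 1 ≤ m) :
    Z (contiguousFloor k a m) =
      weight k Z (Finset.Ico (a - (k - 1)) (a - (k - 1) + (k - 1))) * h ^ m := by
  have h1 := hZ.one_add_X_pow_mul hk (indep_contiguousFloor k a m) (Set.subset_univ _)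
  rw [card_contiguousFloor hk, nb_contiguousFloor hk a hm, hZ.full_weight_eq hk hh] at h1
  have h2 : (1 + X) * h = X * (1 + h) ^ k := by linear_combination hh
  apply (isUnit_one_add_X.pow m).mul_left_cancel
  rw [h1, pow_mul, mul_left_comm, ← mul_pow, mul_left_comm, ← mul_pow, h2]

theorem FloorRecursion.singleton_eq {k : ℕ} {Z : Finset ℤ → PowerSeries ℚ}
    (hk : 1 ≤ k) (hZ : FloorRecursion k Set.univ Z) (h0 : Z ∅ = 1) {h : PowerSeries ℚ}
    (hh : h = X * ((1 + h) ^ k - h)) (a : ℤ) :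
    Z {a} = h * (1 + ∑ i ∈ Finset.range (k - 1), Z {a - (k - 1) + i}) := by
  have h1 := hZ.contiguousFloor_eq hk hh a le_rfl
  rw [contiguousFloor_one, pow_one, weight_short, h0] at h1
  · rw [h1, mul_comm]
    congr 2
    refine (Finset.sum_bij (fun (i : ℕ) _ => a - (k - 1) + (i : ℤ)) ?_ ?_ ?_ ?_).symm
    · intro i hi
      have := Finset.mem_range.1 hi
      rw [Finset.mem_Ico]
      omega
    · intro i _ j _ hij
      simpa using hij
    · intro y hy
      have := Finset.mem_Ico.1 hy
      exact ⟨(y - (a - (k - 1))).toNat, Finset.mem_range.2 (by omega), by omega⟩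
    · intro i _
      rfl
  · intro x hx y hy
    rw [Finset.mem_Ico] at hx hy
    constructor <;> omega

/-- The weight of a pyramid does not depend on its position. -/
theorem FloorRecursion.singleton_succ {k : ℕ} {Z : Finset ℤ → PowerSeries ℚ}
    (hk : 1 ≤ k) (hZ : FloorRecursion k Set.univ Z) (h0 : Z ∅ = 1) {h : PowerSeries ℚ}
    (hh : h = X * ((1 + h) ^ k - h)) (a : ℤ) :
    Z {a + 1} = Z {a} := by
  -- Translation invariance comes from `singleton_eq` alone: its factor `h` is divisible by `X`, so
  -- precision grows by one at each use.
  have key : ∀ (n : ℕ) (a : ℤ), (X : PowerSeries ℚ) ^ n ∣ Z {a + 1} - Z {a} := by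
    intro n
    induction n with
    | zero => simp
    | succ n ih =>
      intro a
      rw [hZ.singleton_eq hk h0 hh (a + 1), hZ.singleton_eq hk h0 hh a, ← mul_sub,
        add_sub_add_left_eq_sub, ← Finset.sum_sub_distrib, pow_succ']
      refine mul_dvd_mul (X_dvd_of_half_equation hh) (Finset.dvd_sum fun i _ => ?_)
      have : a + 1 - ((k : ℤ) - 1) + i = a - (k - 1) + i + 1 := by ring
      rw [this]
      exact ih _
  exact sub_eq_zero.1 (eq_zero_of_forall_X_pow_dvd fun n => key n a)

theorem FloorRecursion.singleton_const {k : ℕ} {Z : Finset ℤ → PowerSeries ℚ}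
    (hk : 1 ≤ k) (hZ : FloorRecursion k Set.univ Z) (h0 : Z ∅ = 1) {h : PowerSeries ℚ}
    (hh : h = X * ((1 + h) ^ k - h)) (a : ℤ) :
    Z {a} = Z {0} := by
  induction a using Int.induction_on with
  | zero => rfl
  | succ i ih => rw [hZ.singleton_succ hk h0 hh, ih]
  | pred i ih =>
    rw [← ih, ← hZ.singleton_succ hk h0 hh (-(i : ℤ) - 1), sub_add_cancel]

theorem FloorRecursion.pyramid_equation {k : ℕ} {Z : Finset ℤ → PowerSeries ℚ}
    (hk : 1 ≤ k) (hZ : FloorRecursion k Set.univ Z) (h0 : Z ∅ = 1) {h : PowerSeries ℚ}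
    (hh : h = X * ((1 + h) ^ k - h)) :
    Z {0} = h * (1 + ((k : PowerSeries ℚ) - 1) * Z {0}) := by
  have h1 := hZ.singleton_eq hk h0 hh 0
  simp only [hZ.singleton_const hk h0 hh (0 - _ + _)] at h1
  simpa [Nat.cast_sub hk] using h1

theorem FloorRecursion.contiguousFloor_eq_pow {k : ℕ} {Z : Finset ℤ → PowerSeries ℚ}
    (hk : 1 ≤ k) (hZ : FloorRecursion k Set.univ Z)
    {h : PowerSeries ℚ}
    (hh : h = X * ((1 + h) ^ k - h)) (m : ℕ) :
    Z (contiguousFloor k 0 (m + 1)) = Z {0} * h ^ m := by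
  rw [hZ.contiguousFloor_eq hk hh 0 (Nat.le_add_left 1 m), ← contiguousFloor_one k 0,
    hZ.contiguousFloor_eq hk hh 0 le_rfl]
  ring

/-! ### Configurations over a given floor satisfy the recursion -/

/-- `G` may be placed on `F`, all its pieces being in positions from `U`. -/
def CanPlaceIn (k : ℕ) (U : Set ℤ) (F G : Finset ℤ) : Prop :=
  CanPlaceOn k F G ∧ (G : Set ℤ) ⊆ U

/-- The configurations with bottom floor `F`, all higher pieces being in positions from `U`. -/
def IsOver (k : ℕ) (U : Set ℤ) (F : Finset ℤ) (T : Config) : Prop :=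
  T.head? = some F ∧ T.IsChain (CanPlaceIn k U)

theorem canPlaceIn_iff {k : ℕ} {U : Set ℤ} {F G : Finset ℤ} :
    CanPlaceIn k U F G ↔ G.Nonempty ∧ G ∈ indepSubsets k (nb k U F \ F) := by
  constructor
  · rintro ⟨h, hU⟩
    exact ⟨h.nonempty, mem_indepSubsets.2 ⟨fun y hy => Finset.mem_sdiff.2
      ⟨mem_nb.2 ⟨h.supported y hy, hU hy⟩, h.not_aligned y hy⟩, h.disjoint⟩⟩
  · rintro ⟨hne, h⟩
    obtain ⟨hs, hi⟩ := mem_indepSubsets.1 h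
    exact ⟨⟨hne, hi, fun y hy => (mem_nb.1 (Finset.mem_sdiff.1 (hs hy)).1).1,
      fun y hy => (Finset.mem_sdiff.1 (hs hy)).2⟩,
      fun y hy => (mem_nb.1 (Finset.mem_sdiff.1 (hs hy)).1).2⟩

theorem isOver_cons {k : ℕ} {U : Set ℤ} {F G : Finset ℤ} {T : Config} :
    IsOver k U F (G :: T) ↔
      G = F ∧ (T = [] ∨ ∃ G', CanPlaceIn k U F G' ∧ IsOver k U G' T) := by
  simp only [IsOver, List.head?_cons, Option.some.injEq]
  refine and_congr_right ?_
  rintro rfl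
  cases T with
  | nil => simp
  | cons G' T =>
    simp only [List.isChain_cons_cons, List.head?_cons, Option.some.injEq, reduceCtorEq, false_or]
    constructor
    · rintro ⟨h1, h2⟩
      exact ⟨G', h1, rfl, h2⟩
    · rintro ⟨G'', h1, rfl, h2⟩
      exact ⟨h1, h2⟩

theorem isOver_empty {k : ℕ} {U : Set ℤ} {T : Config} : IsOver k U ∅ T ↔ T = [∅] := by
  cases T with
  | nil => simp [IsOver]
  | cons G T =>
    rw [isOver_cons, List.cons.injEq]
    refine and_congr_right fun _ => or_iff_left ?_
    rintro ⟨G', h, -⟩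
    obtain ⟨y, hy⟩ := h.1.nonempty
    obtain ⟨x, hx, -⟩ := h.1.supported y hy
    simp at hx

theorem numPieces_cons (F : Finset ℤ) (T : Config) :
    numPieces (F :: T) = F.card + numPieces T := by
  simp [numPieces]

/-- Put the floor `F` under a configuration; the configuration `[∅]` stands for nothing. -/
noncomputable def putUnder (F : Finset ℤ) (T : Config) : Config :=
  open Classical in F :: if T = [∅] then [] else T

theorem putUnder_injOn (F : Finset ℤ) : Set.InjOn (putUnder F) {T | T ≠ []} := by
  intro T hT T' hT' h
  simp only [putUnder, List.cons.injEq, true_and] at h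
  simp only [Set.mem_ofPred_eq] at hT hT'
  split_ifs at h with h1 h2 h2
  · rw [h1, h2]
  · exact absurd h.symm hT'
  · exact absurd h hT
  · exact h

theorem numPieces_putUnder (F : Finset ℤ) (T : Config) :
    numPieces (putUnder F T) = F.card + numPieces T := by
  unfold putUnder
  split_ifs with h
  · simp [h, numPieces]
  · rw [numPieces_cons]

theorem isOver_ne_nil {k : ℕ} {U : Set ℤ} {F : Finset ℤ} {T : Config} (h : IsOver k U F T) :
    T ≠ [] := by
  rintro rfl
  simpa using h.1

/-- The choice `G = ∅`, with its only configuration `[∅]`, encodes that `F` is the top floor; this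
makes the recursion uniform. -/
theorem isOver_iff_putUnder {k : ℕ} {U : Set ℤ} {F : Finset ℤ} (hF : F.Nonempty) {T : Config} :
    IsOver k U F T ↔
      ∃ G ∈ indepSubsets k (nb k U F \ F), ∃ T', IsOver k U G T' ∧ putUnder F T' = T := by
  constructor
  · intro h
    cases T with
    | nil => exact absurd rfl (isOver_ne_nil h)
    | cons G T =>
      obtain ⟨rfl, rfl | ⟨G', h1, h2⟩⟩ := isOver_cons.1 h
      · exact ⟨∅, mem_indepSubsets.2 ⟨Finset.empty_subset _, indep_empty k⟩, [∅],
          isOver_empty.2 rfl, by simp [putUnder]⟩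
      · refine ⟨G', (canPlaceIn_iff.1 h1).2, T, h2, ?_⟩
        have : T ≠ [∅] := by
          rintro rfl
          have h3 : ∅ = G' := by simpa using h2.1
          exact h1.1.nonempty.ne_empty h3.symm
        simp [putUnder, this]
  · rintro ⟨G, hG, T', hT', rfl⟩
    rw [putUnder, isOver_cons]
    refine ⟨rfl, ?_⟩
    split_ifs with h
    · exact Or.inl rfl
    · refine Or.inr ⟨G, canPlaceIn_iff.2 ⟨?_, hG⟩, hT'⟩
      rw [Finset.nonempty_iff_ne_empty]
      rintro rfl
      exact h (isOver_empty.1 hT')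

theorem withPieces_isOver_eq_empty {k : ℕ} {U : Set ℤ} {F : Finset ℤ} {n : ℕ} (h : n < F.card) :
    withPieces (IsOver k U F) n = ∅ := by
  refine Set.eq_empty_of_forall_notMem ?_
  rintro T ⟨hT, hn⟩
  cases T with
  | nil => exact isOver_ne_nil hT rfl
  | cons G T =>
    obtain ⟨rfl, -⟩ := isOver_cons.1 hT
    rw [numPieces_cons] at hn
    omega

theorem withPieces_isOver_eq_image {k : ℕ} {U : Set ℤ} {F : Finset ℤ} (hF : F.Nonempty) (n : ℕ) :
    withPieces (IsOver k U F) (n + F.card) =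
      putUnder F '' ⋃ G ∈ (indepSubsets k (nb k U F \ F) : Set (Finset ℤ)),
        withPieces (IsOver k U G) n := by
  ext T
  simp only [withPieces, Set.mem_ofPred_eq, Set.mem_image, Set.mem_iUnion, Finset.mem_coe,
    exists_prop, isOver_iff_putUnder hF]
  constructor
  · rintro ⟨⟨G, hG, T', hT', rfl⟩, hn⟩
    rw [numPieces_putUnder] at hn
    exact ⟨T', ⟨G, hG, hT', by omega⟩, rfl⟩
  · rintro ⟨T', ⟨G, hG, hT', hn⟩, rfl⟩
    refine ⟨⟨G, hG, T', hT', rfl⟩, ?_⟩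
    rw [numPieces_putUnder]
    omega

theorem finite_withPieces_isOver (k : ℕ) (U : Set ℤ) (n : ℕ) (F : Finset ℤ) :
    (withPieces (IsOver k U F) n).Finite := by
  induction n using Nat.strong_induction_on generalizing F with
  | _ n ih =>
    rcases F.eq_empty_or_nonempty with rfl | hF
    · refine (Set.finite_singleton [∅]).subset ?_
      rintro T ⟨hT, -⟩
      exact isOver_empty.1 hT
    · rcases lt_or_ge n F.card with h | h
      · rw [withPieces_isOver_eq_empty h]
        exact Set.finite_empty
      · obtain ⟨m, rfl⟩ := Nat.exists_eq_add_of_le' h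
        rw [withPieces_isOver_eq_image hF]
        have := hF.card_pos
        exact ((Finset.finite_toSet _).biUnion fun G _ => ih m (by omega) G).image _

theorem pairwiseDisjoint_withPieces (k : ℕ) (U : Set ℤ) (n : ℕ) (s : Set (Finset ℤ)) :
    s.PairwiseDisjoint fun G => withPieces (IsOver k U G) n := by
  intro G _ G' _ hne
  refine Set.disjoint_left.2 fun T hT hT' => hne ?_
  have := hT.1.1.symm.trans hT'.1.1
  simpa using this

theorem ncard_withPieces_isOver {k : ℕ} {U : Set ℤ} {F : Finset ℤ} (hF : F.Nonempty) (n : ℕ) :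
    (withPieces (IsOver k U F) (n + F.card)).ncard =
      ∑ G ∈ indepSubsets k (nb k U F \ F), (withPieces (IsOver k U G) n).ncard := by
  rw [withPieces_isOver_eq_image hF, Set.InjOn.ncard_image,
    Set.Finite.ncard_biUnion (Finset.finite_toSet _)
      (fun G _ => finite_withPieces_isOver k U n G) (pairwiseDisjoint_withPieces k U n _),
    finsum_mem_coe_finset]
  refine (putUnder_injOn F).mono ?_
  intro T hT
  simp only [Set.mem_iUnion] at hT
  obtain ⟨G, -, hT⟩ := hT
  exact isOver_ne_nil hT.1

/-- The generating function of the configurations with a given bottom floor. -/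
noncomputable def overGenFun (k : ℕ) (U : Set ℤ) (F : Finset ℤ) : PowerSeries ℚ :=
  genFun (IsOver k U F)

theorem overGenFun_empty (k : ℕ) (U : Set ℤ) : overGenFun k U ∅ = 1 := by
  ext n
  rw [overGenFun, genFun, coeff_mk, coeff_one]
  split_ifs with h
  · have : withPieces (IsOver k U ∅) n = {[∅]} := by
      ext T
      simp only [withPieces, isOver_empty, Set.mem_ofPred_eq, Set.mem_singleton_iff,
        and_iff_left_iff_imp]
      rintro rfl
      simp [numPieces, h]
    simp [this]
  · have : withPieces (IsOver k U ∅) n = ∅ := by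
      refine Set.eq_empty_of_forall_notMem ?_
      rintro T ⟨hT, hn⟩
      rw [isOver_empty.1 hT] at hn
      exact h (by simpa [numPieces] using hn.symm)
    simp [this]

theorem floorRecursion_overGenFun (k : ℕ) (U : Set ℤ) : FloorRecursion k U (overGenFun k U) := by
  intro F
  rcases F.eq_empty_or_nonempty with rfl | hF
  · simp
  ext n
  rw [coeff_X_pow_mul']
  split_ifs with h
  · obtain ⟨m, rfl⟩ := Nat.exists_eq_add_of_le' h
    rw [Nat.add_sub_cancel, weight, map_sum]
    simp only [overGenFun, genFun, coeff_mk]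
    rw [ncard_withPieces_isOver hF]
    push_cast
    rfl
  · rw [overGenFun, genFun, coeff_mk, withPieces_isOver_eq_empty (not_le.1 h)]
    simp

/-! ### Towers, pyramids and half-pyramids as configurations over a floor -/

theorem canPlaceIn_univ (k : ℕ) : CanPlaceIn k Set.univ = CanPlaceOn k := by
  ext F G
  simp [CanPlaceIn]

theorem isPyramid_iff {k : ℕ} {a : ℤ} {T : Config} :
    IsPyramid k a T ↔ IsOver k Set.univ {a} T := by
  simp only [IsPyramid, IsTower, IsOver, canPlaceIn_univ]
  constructor
  · rintro ⟨⟨-, h1⟩, h2⟩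
    exact ⟨h2, h1⟩
  · rintro ⟨h1, h2⟩
    exact ⟨⟨⟨1, le_rfl, by rw [h1, contiguousFloor_one]⟩, h2⟩, h1⟩

theorem isTower_iff {k : ℕ} {a : ℤ} {T : Config} :
    IsTower k a T ↔ ∃ m, 1 ≤ m ∧ IsOver k Set.univ (contiguousFloor k a m) T := by
  simp only [IsTower, IsOver, canPlaceIn_univ]
  constructor
  · rintro ⟨⟨m, hm, h⟩, h'⟩
    exact ⟨m, hm, h, h'⟩
  · rintro ⟨m, hm, h, h'⟩
    exact ⟨⟨m, hm, h⟩, h'⟩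

theorem isOver_iff_of_subset {k : ℕ} {U : Set ℤ} {F : Finset ℤ} (hF : (F : Set ℤ) ⊆ U)
    {T : Config} :
    IsOver k U F T ↔ IsOver k Set.univ F T ∧ ∀ G ∈ T, (G : Set ℤ) ⊆ U := by
  induction T generalizing F with
  | nil => simp [IsOver]
  | cons G T ih =>
    rw [isOver_cons, isOver_cons, List.forall_mem_cons]
    constructor
    · rintro ⟨rfl, rfl | ⟨G', h1, h2⟩⟩
      · simpa using hF
      · obtain ⟨h3, h4⟩ := (ih h1.2).1 h2
        exact ⟨⟨rfl, Or.inr ⟨G', ⟨h1.1, Set.subset_univ _⟩, h3⟩⟩, hF, h4⟩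
    · rintro ⟨⟨rfl, rfl | ⟨G', h1, h2⟩⟩, h3, h4⟩
      · exact ⟨rfl, Or.inl rfl⟩
      · have hG' : (G' : Set ℤ) ⊆ U := h4 G' (List.mem_of_mem_head? h2.1)
        exact ⟨rfl, Or.inr ⟨G', ⟨h1.1, hG'⟩, (ih hG').2 ⟨h2, h4⟩⟩⟩

theorem isHalfPyramid_iff {k : ℕ} {a : ℤ} {T : Config} :
    IsHalfPyramid k a T ↔ IsOver k (Set.Ici a) {a} T := by
  rw [isOver_iff_of_subset (by simp), IsHalfPyramid, isPyramid_iff]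
  rfl

theorem P_eq (k : ℕ) : P k = overGenFun k Set.univ {0} := by
  simp only [P, overGenFun, genFun, withPieces, isPyramid_iff]

theorem H_eq (k : ℕ) : H k = overGenFun k (Set.Ici 0) {0} := by
  simp only [H, overGenFun, genFun, withPieces, isHalfPyramid_iff]

theorem withPieces_isTower {k : ℕ} (hk : 1 ≤ k) (n : ℕ) :
    withPieces (IsTower k 0) n =
      ⋃ m ∈ (Finset.range n : Set ℕ),
        withPieces (IsOver k Set.univ (contiguousFloor k 0 (m + 1))) n := by
  ext T
  simp only [Set.mem_iUnion, Finset.coe_range, Set.mem_Iio, exists_prop]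
  constructor
  · rintro ⟨hT, hn⟩
    obtain ⟨m, hm, h⟩ := isTower_iff.1 hT
    obtain ⟨m, rfl⟩ := Nat.exists_eq_add_of_le' hm
    refine ⟨m, ?_, h, hn⟩
    by_contra hlt
    have h1 : T ∈ withPieces (IsOver k Set.univ (contiguousFloor k 0 (m + 1))) n := ⟨h, hn⟩
    rw [withPieces_isOver_eq_empty (by rw [card_contiguousFloor hk]; omega)] at h1
    exact h1
  · rintro ⟨m, -, h, hn⟩
    exact ⟨isTower_iff.2 ⟨m + 1, by omega, h⟩, hn⟩

theorem finite_withPieces_isTower {k : ℕ} (hk : 1 ≤ k) (n : ℕ) :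
    (withPieces (IsTower k 0) n).Finite := by
  rw [withPieces_isTower hk]
  exact (Finset.finite_toSet _).biUnion fun m _ => finite_withPieces_isOver k _ n _

theorem contiguousFloor_injective {k : ℕ} (hk : 1 ≤ k) (a : ℤ) :
    Function.Injective (contiguousFloor k a) := by
  intro m m' h
  rw [← card_contiguousFloor hk a m, h, card_contiguousFloor hk]

theorem ncard_withPieces_isTower {k : ℕ} (hk : 1 ≤ k) (n : ℕ) :
    (withPieces (IsTower k 0) n).ncard = ∑ m ∈ Finset.range n,
      (withPieces (IsOver k Set.univ (contiguousFloor k 0 (m + 1))) n).ncard := by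
  rw [withPieces_isTower hk, Set.Finite.ncard_biUnion (Finset.finite_toSet _)
      (fun m _ => finite_withPieces_isOver k _ n _), finsum_mem_coe_finset]
  intro m _ m' _ hne
  refine Set.disjoint_left.2 fun T hT hT' => hne ?_
  have h := hT.1.1.symm.trans hT'.1.1
  simpa using contiguousFloor_injective hk 0 (Option.some.inj h)

theorem coeff_M {k : ℕ} (hk : 1 ≤ k) (n : ℕ) :
    coeff n (M k) =
      coeff n (∑ m ∈ Finset.range n, overGenFun k Set.univ (contiguousFloor k 0 (m + 1))) := by
  rw [map_sum]
  simp only [M, overGenFun, genFun, coeff_mk]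
  rw [ncard_withPieces_isTower hk]
  push_cast
  rfl

theorem overGenFun_eq_zero_coeff {k : ℕ} (hk : 1 ≤ k) {n m : ℕ} (h : n < m) :
    coeff n (overGenFun k Set.univ (contiguousFloor k 0 m)) = 0 := by
  rw [overGenFun, genFun, coeff_mk,
    withPieces_isOver_eq_empty (by rwa [card_contiguousFloor hk])]
  simp

/-- A bottom floor of `m + 1` pieces contributes only from degree `m + 1` on, so the infinite sum
over bottom floors can be truncated. -/
theorem X_pow_dvd_M_sub {k : ℕ} (hk : 1 ≤ k) (N : ℕ) :
    (X : PowerSeries ℚ) ^ N ∣ M k -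
      ∑ m ∈ Finset.range N, overGenFun k Set.univ (contiguousFloor k 0 (m + 1)) := by
  rw [X_pow_dvd_iff]
  intro n hn
  rw [map_sub, coeff_M hk, map_sum, map_sum, sub_eq_zero]
  refine Finset.sum_subset (Finset.range_subset_range.2 hn.le) fun m _ hm => ?_
  exact overGenFun_eq_zero_coeff hk (by simpa [Nat.lt_succ_iff] using hm)

/-! ### The functional equations and closed forms -/

theorem H_equation {k : ℕ} (hk : 1 ≤ k) : H k = X * ((1 + H k) ^ k - H k) := by
  rw [H_eq]
  exact (floorRecursion_overGenFun k _).half_equation hk (overGenFun_empty k _)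

theorem constantCoeff_H {k : ℕ} (hk : 1 ≤ k) : constantCoeff (H k) = 0 := by
  rw [H_equation hk]
  simp

theorem P_equation {k : ℕ} (hk : 1 ≤ k) :
    P k = H k * (1 + ((k : PowerSeries ℚ) - 1) * P k) := by
  rw [P_eq]
  exact (floorRecursion_overGenFun k _).pyramid_equation hk (overGenFun_empty k _) (H_equation hk)

/-- This is the geometric series `M = P * ∑ H ^ m`, read modulo `X ^ N` because `X ∣ H`. -/
theorem M_mul {k : ℕ} (hk : 1 ≤ k) : M k * (1 - H k) = P k := by
  refine sub_eq_zero.1 (eq_zero_of_forall_X_pow_dvd fun N => ?_)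
  have h := X_pow_dvd_M_sub hk N
  simp only [(floorRecursion_overGenFun k _).contiguousFloor_eq_pow hk (H_equation hk),
    ← Finset.mul_sum, ← P_eq] at h
  have h1 : M k * (1 - H k) - P k =
      (M k - P k * ∑ m ∈ Finset.range N, H k ^ m) * (1 - H k) - P k * H k ^ N := by
    linear_combination P k * geom_sum_mul_neg (H k) N
  rw [h1]
  exact dvd_sub (h.mul_right _)
    ((pow_dvd_pow_of_dvd (X_dvd_of_half_equation (H_equation hk)) N).mul_left _)

theorem P_formula {k : ℕ} (hk : 1 ≤ k) :
    P k = H k * (1 - ((k : PowerSeries ℚ) - 1) * H k)⁻¹ := by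
  rw [PowerSeries.eq_mul_inv_iff_mul_eq (by simp [constantCoeff_H hk])]
  linear_combination P_equation hk

theorem M_formula {k : ℕ} (hk : 1 ≤ k) :
    M k = H k * ((1 - ((k : PowerSeries ℚ) - 1) * H k) * (1 - H k))⁻¹ := by
  rw [PowerSeries.eq_mul_inv_iff_mul_eq (by simp [constantCoeff_H hk])]
  linear_combination (1 - ((k : PowerSeries ℚ) - 1) * H k) * M_mul hk + P_equation hk

/-! ### Dimers -/

/-- For `k = 2`, `H = X (1 + H + H ^ 2)` gives `X (1 - H) ^ 2 = H (1 - 3 X)`, while `M (1 - H) ^ 2 =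
H`; cancelling `H` leaves the claim. -/
theorem M_two : M 2 * (1 - 3 * X) = X := by
  have hP := P_equation (k := 2) one_le_two
  have hH := H_equation (k := 2) one_le_two
  have hM := M_mul (k := 2) one_le_two
  have h0 : H 2 ≠ 0 := by
    intro h
    rw [h] at hH
    exact X_ne_zero (R := ℚ) (by simpa using hH.symm)
  push_cast at hP
  apply mul_right_cancel₀ h0
  linear_combination X * ((1 - H 2) * hM + hP) + M 2 * hH

theorem coeff_M_two (n : ℕ) : coeff (n + 1) (M 2) = 3 ^ n := by
  have h (n : ℕ) : coeff (n + 1) (M 2) - 3 * coeff n (M 2) = coeff (n + 1) X := by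
    rw [← M_two, show M 2 * (1 - 3 * X) = M 2 - C (3 : ℚ) * (M 2 * X) by
      rw [show (C (3 : ℚ) : PowerSeries ℚ) = 3 from map_ofNat _ 3]; ring, map_sub, coeff_C_mul,
      coeff_succ_mul_X]
  have h0 : coeff 0 (M 2) = 0 := by
    have := coeff_M (k := 2) one_le_two 0
    simpa using this
  induction n with
  | zero =>
    have := h 0
    rw [h0] at this
    simpa [coeff_X] using this
  | succ n ih =>
    have := h (n + 1)
    rw [ih, coeff_X, if_neg (by omega)] at this
    rw [pow_succ]
    linarith

end AlignFreeTowers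

theorem mainTheorem4 :
    (∀ k : ℕ, 1 ≤ k →
      -- all the counts involved are finite
      (∀ n : ℕ, (AlignFreeTowers.withPieces (AlignFreeTowers.IsTower k 0) n).Finite ∧
        (AlignFreeTowers.withPieces (AlignFreeTowers.IsPyramid k 0) n).Finite ∧
        (AlignFreeTowers.withPieces (AlignFreeTowers.IsHalfPyramid k 0) n).Finite) ∧
      -- the denominators below are invertible power series
      PowerSeries.constantCoeff (AlignFreeTowers.H k) = 0 ∧
      AlignFreeTowers.H k =
        PowerSeries.X * ((1 + AlignFreeTowers.H k) ^ k - AlignFreeTowers.H k) ∧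
      AlignFreeTowers.P k =
        AlignFreeTowers.H k * (1 - ((k : PowerSeries ℚ) - 1) * AlignFreeTowers.H k)⁻¹ ∧
      AlignFreeTowers.M k =
        AlignFreeTowers.H k *
          ((1 - ((k : PowerSeries ℚ) - 1) * AlignFreeTowers.H k) *
            (1 - AlignFreeTowers.H k))⁻¹) ∧
    (∀ n : ℕ, 1 ≤ n →
      (AlignFreeTowers.withPieces (AlignFreeTowers.IsTower 2 0) n).ncard = 3 ^ (n - 1)) := by
  refine ⟨fun k hk => ⟨fun n => ?_, AlignFreeTowers.constantCoeff_H hk,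
    AlignFreeTowers.H_equation hk, AlignFreeTowers.P_formula hk, AlignFreeTowers.M_formula hk⟩,
    fun n hn => ?_⟩
  · have h := AlignFreeTowers.finite_withPieces_isTower hk n
    have h' := h.subset (fun T (hT : T ∈ AlignFreeTowers.withPieces
      (AlignFreeTowers.IsPyramid k 0) n) => ⟨hT.1.1, hT.2⟩)
    exact ⟨h, h', h'.subset fun T hT => ⟨hT.1.1, hT.2⟩⟩
  · obtain ⟨n, rfl⟩ := Nat.exists_eq_add_of_le' hn
    have h := AlignFreeTowers.coeff_M_two n
    rw [AlignFreeTowers.M, AlignFreeTowers.genFun, PowerSeries.coeff_mk] at h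
    rw [Nat.add_sub_cancel]
    exact_mod_cast h
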